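/- Let $K$ be a nonzero unital commutative $\mathbb{Q}$-algebra, $\alpha\ge 1$ an integer and $W$ a non-empty set of positive integers. Let $\mathbb{T}^W$ be the set of isomorphism classes of non-empty finite rooted trees whose vertices are labeled by elements of $W$ (isomorphisms preserve roots and labels), and let $|T|$ be the sum of the labels of all vertices of $T$. Let $z=(z_1,\dots,z_n)$ be free variables, either all commuting or all noncommuting, let $R\langle z\rangle$ be the corresponding polynomial algebra over a commutative ring $R$, and let $t$ be a central parameter. For $u\in R\langle z\rangle^{n}$ let $[u\frac{\partial}{\partial z}]$ be the $R$-derivation of $R\langle z\rangle$ with $z_i\mapsto u_i$. Let $\mathbb{B}_t^{[\alpha]}\langle z\rangle$ be the set of automorphisms $F_t=z-H_t(z)$ of the $K[t]$-algebra $K[t]\langle z\rangle$ such that $H_{t=0}(z)=0$; all components of $H_t(z)$ are homogeneous in $z$ of one common degree $d\ge\alpha$; and, after a suitable permutation of the variables $z_i$, the Jacobian matrix $JH_t$ is strictly lower triangular. Here $JH_t$ has entries $\partial H_{t,i}/\partial z_j$ in the commutative case; in the noncommutative case its $(i,j)$ entry is the operator $u\mapsto[u\frac{\partial}{\partial z_j}]H_{t,i}$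 on $K[t]\langle z\rangle$, where $[u\frac{\partial}{\partial z_j}]$ is the derivation with $z_j\mapsto u$ and $z_k\mapsto 0$ for $k\ne j$. If $H_t(z)=\sum_{m\in W}t^mH_{[m]}(z)$ with $H_{[m]}(z)\in K\langle z\rangle^{n}$ (almost all zero), define $P_T(z)\in K\langle z\rangle^{n}$ for $T\in\mathbb{T}^W$ inductively: if the root of $T$ has label $m$ and $T_1,\dots,T_k$ ($k\ge 0$) are the branches of $T$ at its root, then $$P_T(z)=\Big[P_{T_1}(w)\tfrac{\partial}{\partial z}\Big]\cdots\Big[P_{T_k}(w)\tfrac{\partial}{\partial z}\Big]H_{[m]}(z)\Big|_{w=z},$$ where $w=(w_1,\dots,w_n)$ is a second set of independent variables, which the derivations treat as constants, and the derivations act on each component of $H_{[m]}$. In particular $P_T=H_{[m]}$ if $T$ is a single vertex labeled $m$. **Lemma.** In both the commutative and the noncommutative case the following holds. For any $T\in\mathbb{T}^W$ there exist $n\ge 1$ and $F_t\in\mathbb{B}_t^{[\alpha]}\langle z\rangle$, with $H_t(z)=\sum_{m\in W}t^mH_{[m]}(z)$ for some $H_{[m]}(z)\in K\langle z\rangle^{n}$,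 such that $P_T(z)\ne 0$ and $P_{T'}(z)=0$ for every $T'\in\mathbb{T}^W$ with $|T'|\ge|T|$ and $T'\not\simeq T$. -/

import Mathlib

open Polynomial

noncomputable section

/-! ### Labeled rooted trees -/

/-- Finite (nonempty) rooted trees with vertices labeled by `L`: `node m d c` is the tree whose
root is labeled by `m` and whose branches, i.e. the trees hanging at the children of the root,
are `c 0, …, c (d - 1)`. The order of the branches is forgotten by `LTree.Iso`. -/
inductive LTree (L : Type) : Type
  | node (m : L) (d : ℕ) (c : Fin d → LTree L) : LTree L

namespace LTree

/-- Isomorphism of labeled rooted trees, preserving the root and the labels of vertices: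
the roots have the same label, and the branches correspond bijectively up to isomorphism. -/
def Iso {L : Type} : LTree L → LTree L → Prop
  | node m d c, node m' d' c' =>
      m = m' ∧ ∃ σ : Fin d ≃ Fin d', ∀ i, Iso (c i) (c' (σ i))

/-- The weight `|T|`: the sum of the labels of all vertices. -/
def weight {W : Set ℕ+} : LTree W → ℕ
  | node m d c => ((m : ℕ+) : ℕ) + ∑ i : Fin d, weight (c i)

end LTree

/-- A square matrix is strictly lower triangular up to a simultaneous permutation of its
rows and columns. -/
def IsPermStrictLower {n : ℕ} {A : Type*} [Zero A] (J : Matrix (Fin n) (Fin n) A) : Prop :=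
  ∃ σ : Equiv.Perm (Fin n), ∀ i j, i ≤ j → J.submatrix σ σ i j = 0

/-! ### Noncommutative free variables -/

namespace NonComm

/-- The derivation `[u ∂/∂z]` of the free algebra `R⟨z⟩`: the unique `R`-derivation with
`z_i ↦ u_i`. It is the `ε`-component of the algebra homomorphism
`R⟨z⟩ → R⟨z⟩[ε]`, `z_i ↦ z_i + ε u_i`, with `ε² = 0`. -/
def der {R σ : Type*} [CommRing R] (u : σ → FreeAlgebra R σ) (p : FreeAlgebra R σ) :
    FreeAlgebra R σ :=
  (FreeAlgebra.lift R (fun i =>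
    (TrivSqZeroExt.inl (FreeAlgebra.ι R i) + TrivSqZeroExt.inr (u i) :
      TrivSqZeroExt (FreeAlgebra R σ) (FreeAlgebra R σ))) p).snd

theorem der_ι {R σ : Type*} [CommRing R] (u : σ → FreeAlgebra R σ) (i : σ) :
    der u (FreeAlgebra.ι R i) = u i := by
  simp [der]

theorem der_add {R σ : Type*} [CommRing R] (u : σ → FreeAlgebra R σ) (p q : FreeAlgebra R σ) :
    der u (p + q) = der u p + der u q := by
  simp [der]

theorem der_smul {R σ : Type*} [CommRing R] (u : σ → FreeAlgebra R σ) (r : R)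
    (p : FreeAlgebra R σ) : der u (r • p) = r • der u p := by
  simp [der]

theorem lift_fst {R σ : Type*} [CommRing R] (u : σ → FreeAlgebra R σ) (p : FreeAlgebra R σ) :
    (FreeAlgebra.lift R (fun i =>
      (TrivSqZeroExt.inl (FreeAlgebra.ι R i) + TrivSqZeroExt.inr (u i) :
        TrivSqZeroExt (FreeAlgebra R σ) (FreeAlgebra R σ))) p).fst = p := by
  have h : (TrivSqZeroExt.fstHom R (FreeAlgebra R σ) (FreeAlgebra R σ)).comp
      (FreeAlgebra.lift R (fun i =>
        (TrivSqZeroExt.inl (FreeAlgebra.ι R i) + TrivSqZeroExt.inr (u i) :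
          TrivSqZeroExt (FreeAlgebra R σ) (FreeAlgebra R σ)))) = AlgHom.id R _ := by
    ext i
    simp
  exact DFunLike.congr_fun h p

theorem der_mul {R σ : Type*} [CommRing R] (u : σ → FreeAlgebra R σ) (p q : FreeAlgebra R σ) :
    der u (p * q) = p * der u q + der u p * q := by
  simp only [der, map_mul, TrivSqZeroExt.snd_mul, lift_fst, smul_eq_mul,
    MulOpposite.smul_eq_mul_unop, MulOpposite.unop_op]

/-- The multilinear operator `B₊([v₁ ∂/∂z], …, [v_k ∂/∂z])` applied to `p`:
introduce a second copy `w` of the variables (`Sum.inl` is `z`, `Sum.inr` is `w`), apply the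
derivations `[v₁(w) ∂/∂z] ⋯ [v_k(w) ∂/∂z]`, which treat `w` as constants, to `p(z)`, and
then put `w = z`. For the empty list it returns `p`. -/
def Bplus {R σ : Type*} [CommRing R] (v : List (σ → FreeAlgebra R σ)) (p : FreeAlgebra R σ) :
    FreeAlgebra R σ :=
  FreeAlgebra.lift R (Sum.elim (FreeAlgebra.ι R) (FreeAlgebra.ι R))
    (v.foldr
      (fun u q => der (Sum.elim
        (fun i => FreeAlgebra.lift R (fun j => FreeAlgebra.ι R (Sum.inr j : σ ⊕ σ)) (u i))
        (fun _ => 0)) q)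
      (FreeAlgebra.lift R (fun j => FreeAlgebra.ι R (Sum.inl j : σ ⊕ σ)) p))

/-- The polynomial vectors `P_T(z)`, for a family `H_{[m]}` (`m ∈ W`):
`P_T = B₊([P_{T₁} ∂/∂z], …, [P_{T_d} ∂/∂z]) H_{[m]}` (componentwise) if the root of `T` is
labeled by `m` and `T₁, …, T_d` are the branches; in particular `P_T = H_{[m]}` for `d = 0`. -/
def P {K L : Type*} {W : Type} [CommRing K] (H : W → L → FreeAlgebra K L) :
    LTree W → L → FreeAlgebra K L
  | .node m _ c => fun i => Bplus (List.ofFn fun j => P H (c j)) (H m i)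

/-- Homogeneous elements of degree `d` in the free algebra: linear combinations of words of
length `d` in the variables. -/
def IsHomogeneous {R σ : Type*} [CommRing R] (p : FreeAlgebra R σ) (d : ℕ) : Prop :=
  p ∈ Submodule.span R
    (Set.range fun w : Fin d → σ => (List.ofFn fun k => FreeAlgebra.ι R (w k)).prod)

/-- Change of coefficients `R⟨z⟩ → S⟨z⟩` along a ring homomorphism `R → S`. -/
def mapCoeff {R S σ : Type*} [CommRing R] [CommRing S] (f : R →+* S) :
    FreeAlgebra R σ →+* FreeAlgebra S σ :=
  let _ : Algebra R (FreeAlgebra S σ) := Algebra.compHom (FreeAlgebra S σ) f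
  (FreeAlgebra.lift R (FreeAlgebra.ι S : σ → FreeAlgebra S σ)).toRingHom

theorem mapCoeff_ι {R S σ : Type*} [CommRing R] [CommRing S] (f : R →+* S) (i : σ) :
    mapCoeff f (FreeAlgebra.ι R i) = FreeAlgebra.ι S i := by
  let _ : Algebra R (FreeAlgebra S σ) := Algebra.compHom (FreeAlgebra S σ) f
  exact FreeAlgebra.lift_ι_apply _ _

theorem mapCoeff_algebraMap {R S σ : Type*} [CommRing R] [CommRing S] (f : R →+* S) (r : R) :
    mapCoeff f (algebraMap R (FreeAlgebra R σ) r) = algebraMap S (FreeAlgebra S σ) (f r) := by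
  let _ : Algebra R (FreeAlgebra S σ) := Algebra.compHom (FreeAlgebra S σ) f
  exact (FreeAlgebra.lift R (FreeAlgebra.ι S : σ → FreeAlgebra S σ)).commutes r

/-- The Jacobian matrix of `H` in noncommutative variables. Its `(i, j)` entry is the operator
`u ↦ [u ∂/∂z_j] H_i`, the noncommutative counterpart of multiplication by `∂H_i/∂z_j`
(the value at `u = 1` is the derivative of `H_i` with `z_j ↦ 1`). -/
def jacobian {R : Type*} [CommRing R] {n : ℕ} (H : Fin n → FreeAlgebra R (Fin n)) :
    Matrix (Fin n) (Fin n) (FreeAlgebra R (Fin n) → FreeAlgebra R (Fin n)) :=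
  Matrix.of fun i j u => der (Pi.single j u) (H i)

/-- For an automorphism `F_t` of `K[t]⟨z⟩` over `K[t]`, determined by the images
`F_{t,i}(z)` of the `z_i`, the vector `H_t(z) = z - F_t(z)`. -/
def Hpart {K : Type*} [CommRing K] {n : ℕ}
    (F : FreeAlgebra K[X] (Fin n) ≃ₐ[K[X]] FreeAlgebra K[X] (Fin n)) :
    Fin n → FreeAlgebra K[X] (Fin n) :=
  fun i => FreeAlgebra.ι K[X] i - F (FreeAlgebra.ι K[X] i)

/-- The set `𝔹_t^{[α]}⟨z⟩` in `n` noncommutative variables: automorphisms `F_t = z - H_t(z)` of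
`K[t]⟨z⟩` over `K[t]` with `H_{t=0} = 0`, `H_t` homogeneous in `z` of some degree `d ≥ α`, and
strictly lower triangular Jacobian matrix after a permutation of the variables. -/
def triangularAut (K : Type*) [CommRing K] (α n : ℕ) :
    Set (FreeAlgebra K[X] (Fin n) ≃ₐ[K[X]] FreeAlgebra K[X] (Fin n)) :=
  {F | (∀ i, mapCoeff (evalRingHom (0 : K)) (Hpart F i) = 0) ∧
    (∃ d, α ≤ d ∧ ∀ i, IsHomogeneous (Hpart F i) d) ∧
    IsPermStrictLower (jacobian (Hpart F))}

/-- `H_t(z) = ∑_{m ∈ W} t^m H_{[m]}(z)`, with all but finitely many `H_{[m]} ∈ K⟨z⟩^n` zero. -/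
def IsExpansion {K : Type*} [CommRing K] {n : ℕ} {W : Set ℕ+}
    (F : FreeAlgebra K[X] (Fin n) ≃ₐ[K[X]] FreeAlgebra K[X] (Fin n))
    (H : W →₀ (Fin n → FreeAlgebra K (Fin n))) : Prop :=
  ∀ i, Hpart F i =
    H.sum fun m h => (X ^ ((m : ℕ+) : ℕ) : K[X]) • mapCoeff (C : K →+* K[X]) (h i)

end NonComm

/-! ### Commutative variables -/

namespace Commut

/-- The operator `B₊([v₁ ∂/∂z], …, [v_k ∂/∂z])` applied to `p`, in commutative variables:
apply the derivations `[v₁(w) ∂/∂z] ⋯ [v_k(w) ∂/∂z]` of the polynomial ring in `z`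
(`Sum.inl`) and `w` (`Sum.inr`) to `p(z)`, and then put `w = z`. -/
def Bplus {R σ : Type*} [CommRing R] (v : List (σ → MvPolynomial σ R)) (p : MvPolynomial σ R) :
    MvPolynomial σ R :=
  MvPolynomial.aeval (Sum.elim MvPolynomial.X MvPolynomial.X)
    (v.foldr
      (fun u q => MvPolynomial.mkDerivation R (Sum.elim
        (fun i => MvPolynomial.rename (Sum.inr : σ → σ ⊕ σ) (u i))
        (fun _ => (0 : MvPolynomial (σ ⊕ σ) R))) q)
      (MvPolynomial.rename (Sum.inl : σ → σ ⊕ σ) p))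

/-- The polynomial vectors `P_T(z)` in commutative variables. -/
def P {K L : Type*} {W : Type} [CommRing K] (H : W → L → MvPolynomial L K) :
    LTree W → L → MvPolynomial L K
  | .node m _ c => fun i => Bplus (List.ofFn fun j => P H (c j)) (H m i)

/-- The Jacobian matrix `(∂H_i/∂z_j)`. -/
def jacobian {R : Type*} [CommRing R] {n : ℕ} (H : Fin n → MvPolynomial (Fin n) R) :
    Matrix (Fin n) (Fin n) (MvPolynomial (Fin n) R) :=
  Matrix.of fun i j => MvPolynomial.pderiv j (H i)

/-- For an automorphism `F_t` of `K[t][z]` over `K[t]`, the vector `H_t(z) = z - F_t(z)`. -/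
def Hpart {K : Type*} [CommRing K] {n : ℕ}
    (F : MvPolynomial (Fin n) K[X] ≃ₐ[K[X]] MvPolynomial (Fin n) K[X]) :
    Fin n → MvPolynomial (Fin n) K[X] :=
  fun i => MvPolynomial.X i - F (MvPolynomial.X i)

/-- The set `𝔹_t^{[α]}⟨z⟩` in `n` commutative variables. -/
def triangularAut (K : Type*) [CommRing K] (α n : ℕ) :
    Set (MvPolynomial (Fin n) K[X] ≃ₐ[K[X]] MvPolynomial (Fin n) K[X]) :=
  {F | (∀ i, MvPolynomial.map (evalRingHom (0 : K)) (Hpart F i) = 0) ∧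
    (∃ d, α ≤ d ∧ ∀ i, (Hpart F i).IsHomogeneous d) ∧
    IsPermStrictLower (jacobian (Hpart F))}

/-- `H_t(z) = ∑_{m ∈ W} t^m H_{[m]}(z)`, with all but finitely many `H_{[m]} ∈ K[z]^n` zero. -/
def IsExpansion {K : Type*} [CommRing K] {n : ℕ} {W : Set ℕ+}
    (F : MvPolynomial (Fin n) K[X] ≃ₐ[K[X]] MvPolynomial (Fin n) K[X])
    (H : W →₀ (Fin n → MvPolynomial (Fin n) K)) : Prop :=
  ∀ i, Hpart F i =
    H.sum fun m h => (X ^ ((m : ℕ+) : ℕ) : K[X]) • MvPolynomial.map (C : K →+* K[X]) (h i)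

end Commut

end

noncomputable section

/-! ### Weights of labeled trees -/

namespace LTree

variable {W : Set ℕ+}

theorem weight_pos (T : LTree W) : 0 < T.weight := by
  cases T with
  | node m d c =>
    have := (m : ℕ+).pos
    simp only [weight]
    omega

theorem weight_branch_lt (m : W) (d : ℕ) (c : Fin d → LTree W) (j : Fin d) :
    (c j).weight < (node m d c).weight := by
  have h1 := (m : ℕ+).pos
  have h2 : (c j).weight ≤ ∑ i, (c i).weight :=
    Finset.single_le_sum (f := fun i => (c i).weight) (fun _ _ => Nat.zero_le _)
      (Finset.mem_univ j)
  simp only [weight]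
  omega

/-- If the branches of one tree inject into those of another with the same root label, with
weights not decreasing and isomorphisms in the case of equality, then the same comparison holds
for the trees themselves. -/
theorem weight_le_and_iso_of_injective (m : W) {d d' : ℕ} (c : Fin d → LTree W)
    (c' : Fin d' → LTree W) (σ : Fin d → Fin d') (hσ : Function.Injective σ)
    (h : ∀ j, (c j).weight ≤ (c' (σ j)).weight ∧
      ((c j).weight = (c' (σ j)).weight → (c j).Iso (c' (σ j)))) :
    (node m d c).weight ≤ (node m d' c').weight ∧
      ((node m d c).weight = (node m d' c').weight → (node m d c).Iso (node m d' c')) := by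
  have h1 : ∑ j, (c j).weight ≤ ∑ j, (c' (σ j)).weight :=
    Finset.sum_le_sum fun j _ => (h j).1
  have h2 : ∑ j, (c' (σ j)).weight = ∑ i ∈ Finset.univ.map ⟨σ, hσ⟩, (c' i).weight := by
    simp
  have h3 : ∑ i ∈ Finset.univ.map ⟨σ, hσ⟩, (c' i).weight ≤ ∑ i, (c' i).weight :=
    Finset.sum_le_sum_of_subset (Finset.subset_univ _)
  refine ⟨by simp only [weight]; omega, fun heq => ?_⟩
  simp only [weight] at heq
  have h4 : ∀ j, (c j).weight = (c' (σ j)).weight := by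
    have := (Finset.sum_eq_sum_iff_of_le (s := Finset.univ) fun j _ => (h j).1).1 (by omega)
    exact fun j => this j (Finset.mem_univ j)
  have hsurj : Function.Surjective σ := by
    intro i
    by_contra hi
    have hlt : ∑ i ∈ Finset.univ.map ⟨σ, hσ⟩, (c' i).weight < ∑ i, (c' i).weight :=
      Finset.sum_lt_sum_of_subset (Finset.subset_univ _) (Finset.mem_univ i)
        (by simpa using hi) (weight_pos _) fun _ _ _ => Nat.zero_le _
    omega
  simp only [Iso, true_and]
  exact ⟨Equiv.ofBijective σ ⟨hσ, hsurj⟩, fun j => (h j).2 (h4 j)⟩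

/-- The number of branches at the root. -/
def arity {L : Type} : LTree L → ℕ
  | node _ d _ => d

/-- The set of all subtrees consisting of a vertex and all its descendants. -/
def subtrees {L : Type} : LTree L → Set (LTree L)
  | node m d c => insert (node m d c) (⋃ j, subtrees (c j))

theorem self_mem_subtrees {L : Type} (T : LTree L) : T ∈ T.subtrees := by
  cases T; simp [subtrees]

theorem finite_subtrees {L : Type} (T : LTree L) : T.subtrees.Finite := by
  induction T with
  | node m d c ih =>
    simp only [subtrees]
    exact (Set.finite_iUnion ih).insert _

theorem branch_mem_subtrees {L : Type} (T : LTree L) (m : L) (d : ℕ) (c : Fin d → LTree L)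
    (h : node m d c ∈ T.subtrees) (j : Fin d) : c j ∈ T.subtrees := by
  induction T with
  | node m' d' c' ih =>
    simp only [subtrees, Set.mem_insert_iff, Set.mem_iUnion] at h ⊢
    rcases h with h | ⟨i, hi⟩
    · cases h
      exact Or.inr ⟨j, self_mem_subtrees _⟩
    · exact Or.inr ⟨i, ih i hi⟩

theorem weight_lt_or_eq_of_mem_subtrees (T S : LTree W) (h : S ∈ T.subtrees) :
    S.weight < T.weight ∨ S = T := by
  induction T with
  | node m d c ih =>
    simp only [subtrees, Set.mem_insert_iff, Set.mem_iUnion] at h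
    rcases h with h | ⟨i, hi⟩
    · exact Or.inr h
    · have := weight_branch_lt m d c i
      rcases ih i hi with h | rfl
      · exact Or.inl (by omega)
      · exact Or.inl this

/-- The weight of a tree, where the missing tree has weight `0`. -/
def optWeight (s : Option (LTree W)) : ℕ := s.elim 0 weight

/-- The root label, if there is a tree. -/
def optLabel {L : Type} : Option (LTree L) → Option L
  | none => none
  | some (node m _ _) => some m

theorem exists_of_optLabel_eq {L : Type} {s : Option (LTree L)} {m : L}
    (h : optLabel s = some m) : ∃ d c, s = some (node m d c) := by
  match s, h with
  | some (node _ d c), rfl => exact ⟨d, c, rfl⟩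

/-- Enumeration of the subtrees of a tree `T` and one additional index (sent to `none`), with
words of a common length `D` that list the branches, padded by the additional index. -/
structure Enum (T : LTree W) (n D : ℕ) where
  tree : Fin n → Option (LTree W)
  word : Fin n → Fin D → Fin n
  root : Fin n
  tree_root : tree root = some T
  lt_or_eq : ∀ i S, tree i = some S → S.weight < T.weight ∨ S = T
  arity_le : ∀ i m d c, tree i = some (node m d c) → d ≤ D
  tree_word : ∀ i m d c, tree i = some (node m d c) → ∀ p : Fin D,
    tree (word i p) = if h : (p : ℕ) < d then some (c ⟨p, h⟩) else none

theorem exists_enum (T : LTree W) (α : ℕ) : ∃ n D, 1 ≤ n ∧ α ≤ D ∧ Nonempty (Enum T n D) := by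
  classical
  have := T.finite_subtrees.to_subtype
  obtain ⟨B, hB⟩ := (T.finite_subtrees.image arity).bddAbove
  obtain ⟨n, ⟨e⟩⟩ := Finite.exists_equiv_fin (Option T.subtrees)
  let tree : Fin n → Option (LTree W) := fun i => (e.symm i).map Subtype.val
  have hmem : ∀ i S, tree i = some S → S ∈ T.subtrees := by
    intro i S h
    obtain ⟨a, -, rfl⟩ := Option.map_eq_some_iff.1 h
    exact a.2
  have hex : ∀ S (hS : S ∈ T.subtrees), tree (e (some ⟨S, hS⟩)) = some S := by
    intro S hS
    simp [tree]
  have hnone : tree (e none) = none := by simp [tree]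
  have hw : ∀ i (p : Fin (max α B)), ∃ i', ∀ m d c, tree i = some (node m d c) →
      tree i' = if h : (p : ℕ) < d then some (c ⟨p, h⟩) else none := by
    intro i p
    rcases hi : tree i with _ | ⟨m, d, c⟩
    · exact ⟨i, by simp⟩
    · by_cases h : (p : ℕ) < d
      · refine ⟨e (some ⟨c ⟨p, h⟩, branch_mem_subtrees T m d c (hmem i _ hi) _⟩), ?_⟩
        intro m' d' c' heq
        cases heq
        rw [dif_pos h]
        exact hex _ (branch_mem_subtrees T m d c (hmem i _ hi) _)
      · refine ⟨e none, ?_⟩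
        intro m' d' c' heq
        cases heq
        rw [dif_neg h, hnone]
  choose word hword using hw
  refine ⟨n, max α B, (Nat.zero_le _).trans_lt (e none).2, le_max_left _ _, ⟨{
    tree := tree
    word := word
    root := e (some ⟨T, T.self_mem_subtrees⟩)
    tree_root := hex T T.self_mem_subtrees
    lt_or_eq := fun i S h => weight_lt_or_eq_of_mem_subtrees T S (hmem i S h)
    arity_le := fun i m d c h =>
      (hB (Set.mem_image_of_mem arity (hmem i _ h))).trans (le_max_right _ _)
    tree_word := fun i m d c h p => hword i p m d c h }⟩⟩

theorem Enum.optWeight_word_lt {T : LTree W} {n D : ℕ} (E : Enum T n D) (i : Fin n) (m : W)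
    (h : optLabel (E.tree i) = some m) (p : Fin D) :
    optWeight (E.tree (E.word i p)) < optWeight (E.tree i) := by
  obtain ⟨d, c, hi⟩ := exists_of_optLabel_eq h
  rw [E.tree_word i m d c hi p, hi]
  split_ifs with hp
  · exact weight_branch_lt m d c ⟨p, hp⟩
  · exact weight_pos _

end LTree

/-! ### Triangular endomorphisms -/

/-- In an algebra with the universal property of a free object on `x`, a triangular substitution
`x i ↦ x i - h i`, where `h i` is a monomial in variables of smaller rank, is invertible. -/
theorem exists_algEquiv_of_triangular {R A L : Type*} [CommRing R] [Ring A] [Algebra R A] {D : ℕ}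
    (x : L → A) (hlift : ∀ f : L → A, ∃ φ : A →ₐ[R] A, ∀ i, φ (x i) = f i)
    (hext : ∀ φ ψ : A →ₐ[R] A, (∀ i, φ (x i) = ψ (x i)) → φ = ψ)
    (a : L → R) (word : L → Fin D → L) (rank : L → ℕ)
    (hrank : ∀ i, a i ≠ 0 → ∀ p, rank (word i p) < rank i) :
    ∃ F : A ≃ₐ[R] A, ∀ i, F (x i) = x i - a i • (List.ofFn fun p => x (word i p)).prod := by
  classical
  obtain ⟨F, hF⟩ := hlift fun i => x i - a i • (List.ofFn fun p => x (word i p)).prod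
  have hg : ∀ N : ℕ, ∃ g : L → A, ∀ i, rank i < N →
      g i = x i + a i • (List.ofFn fun p => g (word i p)).prod := by
    intro N
    induction N with
    | zero => exact ⟨x, by simp⟩
    | succ N ih =>
      obtain ⟨g, hg⟩ := ih
      refine ⟨fun i => if rank i < N then g i
        else x i + a i • (List.ofFn fun p => g (word i p)).prod, fun i hi => ?_⟩
      by_cases ha : a i = 0
      · by_cases hN : rank i < N
        · simp [hN, hg i hN, ha]
        · simp [hN, ha]
      · have hw : ∀ p, rank (word i p) < N := fun p => by
          have := hrank i ha p
          omega
        by_cases hN : rank i < N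
        · simp only [hN, hw, if_true]
          exact hg i hN
        · simp only [hN, hw, if_true, if_false]
  have hg' : ∃ g : L → A, ∀ i, g i = x i + a i • (List.ofFn fun p => g (word i p)).prod := by
    choose g hg using hg
    have hstable : ∀ r i, rank i = r → ∀ N M, rank i < N → rank i < M → g N i = g M i := by
      intro r
      induction r using Nat.strong_induction_on with
      | _ r ih =>
        intro i hi N M hN hM
        rw [hg N i hN, hg M i hM]
        by_cases ha : a i = 0
        · simp [ha]
        · have : ∀ p, g N (word i p) = g M (word i p) := fun p => by
            have := hrank i ha p
            exact ih _ (hi ▸ this) _ rfl N M (this.trans hN) (this.trans hM)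
          simp only [this]
    refine ⟨fun i => g (rank i + 1) i, fun i => ?_⟩
    beta_reduce
    rw [hg (rank i + 1) i (Nat.lt_succ_self _)]
    by_cases ha : a i = 0
    · simp [ha]
    · have : ∀ p, g (rank i + 1) (word i p) = g (rank (word i p) + 1) (word i p) := fun p => by
        have := hrank i ha p
        exact hstable _ _ rfl _ _ (by omega) (by omega)
      simp only [this]
  obtain ⟨g, hg⟩ := hg'
  obtain ⟨G, hG⟩ := hlift g
  have hFg : ∀ r i, rank i = r → F (g i) = x i := by
    intro r
    induction r using Nat.strong_induction_on with
    | _ r ih =>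
      intro i hi
      rw [hg i, map_add, hF, map_smul, map_list_prod, List.map_ofFn]
      by_cases ha : a i = 0
      · simp [ha]
      · have : ∀ p, F (g (word i p)) = x (word i p) := fun p =>
          ih _ (hi ▸ hrank i ha p) _ rfl
        simp [Function.comp_def, this]
  refine ⟨AlgEquiv.ofAlgHom F G (hext _ _ fun i => ?_) (hext _ _ fun i => ?_), hF⟩
  · simp [hG, hFg _ i rfl]
  · simp only [AlgHom.coe_comp, Function.comp_apply, hF, map_sub, map_smul, map_list_prod,
      List.map_ofFn, AlgHom.coe_id, id_eq]
    simp only [Function.comp_def, hG]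
    rw [hg i]
    simp

theorem isPermStrictLower_of_rank {n : ℕ} {A : Type*} [Zero A] (J : Matrix (Fin n) (Fin n) A)
    (rank : Fin n → ℕ) (h : ∀ i j, rank i ≤ rank j → J i j = 0) : IsPermStrictLower J :=
  ⟨Tuple.sort rank, fun _ _ hij => h _ _ (Tuple.monotone_sort rank hij)⟩

/-- The Leibniz rule for a product indexed by positions. -/
theorem leibniz_prod_ofFn {A : Type*} [Ring A] (δ : A → A)
    (hδ : ∀ p q, δ (p * q) = p * δ q + δ p * q) {N : ℕ} (f : Fin N → A) :
    δ (List.ofFn f).prod =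
      ∑ p, (List.ofFn (Function.update f p (δ (f p)))).prod := by
  induction N with
  | zero =>
    have := hδ 1 1
    simpa using this
  | succ N ih =>
    have h0 : ∀ y, List.ofFn (Function.update f 0 y) = y :: List.ofFn fun p => f p.succ := by
      intro y
      simp [List.ofFn_succ, Fin.succ_ne_zero]
    have hs : ∀ p y, List.ofFn (Function.update f (Fin.succ p) y) =
        f 0 :: List.ofFn (Function.update (fun q => f q.succ) p y) := by
      intro p y
      rw [List.ofFn_succ]
      congr 1
      congr 1
      ext q
      simp [Function.update_apply]
    rw [Fin.sum_univ_succ]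
    simp only [h0, hs, List.ofFn_succ, List.prod_cons, hδ, ih]
    rw [← Finset.mul_sum, add_comm]

/-! ### The operators `B₊` on words -/

namespace NonComm

section Words

variable {R L : Type*} [CommRing R]

theorem der_zero {σ : Type*} (u : σ → FreeAlgebra R σ) : der u 0 = 0 := by
  simp [der]

theorem der_sum {σ ι : Type*} (u : σ → FreeAlgebra R σ) (s : Finset ι)
    (f : ι → FreeAlgebra R σ) : der u (∑ i ∈ s, f i) = ∑ i ∈ s, der u (f i) :=
  map_sum (AddMonoidHom.mk' (der u) (der_add u)) f s

theorem der_algebraMap {σ : Type*} (u : σ → FreeAlgebra R σ) (r : R) :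
    der u (algebraMap R _ r) = 0 := by
  rw [der, AlgHom.commutes]
  exact TrivSqZeroExt.snd_inl _ _

/-- The noncommutative monomial of a word. -/
def mono {D : ℕ} (w : Fin D → L) : FreeAlgebra R L :=
  (List.ofFn fun p => FreeAlgebra.ι R (w p)).prod

/-- A derivation kills the monomials in variables that it kills. -/
theorem der_mono_eq_zero {D : ℕ} (u : L → FreeAlgebra R L) (w : Fin D → L)
    (h : ∀ p, u (w p) = 0) : der u (mono w) = 0 := by
  rw [mono, leibniz_prod_ofFn _ (der_mul u)]
  refine Finset.sum_eq_zero fun p _ => List.prod_eq_zero ?_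
  rw [List.mem_ofFn]
  exact ⟨p, by simp [der_ι, h]⟩

/-- The embedding `z ↦ w` onto the second copy of the variables. -/
def inW : FreeAlgebra R L →ₐ[R] FreeAlgebra R (L ⊕ L) :=
  FreeAlgebra.lift R fun j => FreeAlgebra.ι R (Sum.inr j)

/-- The derivation `[u(w) ∂/∂z]` of the free algebra in two sets of variables. -/
def derW (u : L → FreeAlgebra R L) : FreeAlgebra R (L ⊕ L) → FreeAlgebra R (L ⊕ L) :=
  der (Sum.elim (fun i => inW (u i)) fun _ => 0)

/-- The substitution `w = z`. -/
def diag : FreeAlgebra R (L ⊕ L) →ₐ[R] FreeAlgebra R L :=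
  FreeAlgebra.lift R (Sum.elim (FreeAlgebra.ι R) (FreeAlgebra.ι R))

theorem diag_inW (q : FreeAlgebra R L) : diag (inW q) = q := by
  have : (diag (R := R)).comp inW = AlgHom.id R (FreeAlgebra R L) := by
    ext i
    simp [diag, inW]
  exact DFunLike.congr_fun this q

theorem derW_ι_inl (u : L → FreeAlgebra R L) (i : L) :
    derW u (FreeAlgebra.ι R (Sum.inl i)) = inW (u i) := by
  simp [derW, der_ι]

theorem derW_inW (u : L → FreeAlgebra R L) (q : FreeAlgebra R L) : derW u (inW q) = 0 := by
  induction q using FreeAlgebra.induction with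
  | grade0 r => rw [AlgHom.commutes, derW, der_algebraMap]
  | grade1 i => simp [inW, derW, der_ι]
  | mul a b ha hb =>
    rw [map_mul, derW, der_mul]
    rw [derW] at ha hb
    simp [ha, hb]
  | add a b ha hb =>
    rw [map_add, derW, der_add]
    rw [derW] at ha hb
    simp [ha, hb]

theorem derW_zero (u : L → FreeAlgebra R L) : derW u 0 = 0 := der_zero _

/-- The factors of the summand of `[v₁(w) ∂/∂z] ⋯ [v_k(w) ∂/∂z]` applied to a monomial in which
the `j`-th derivation hits the factor at position `τ j`. -/
def factor {D : ℕ} (w : Fin D → L) :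
    (k : ℕ) → (Fin k → L → FreeAlgebra R L) → (Fin k → Fin D) → Fin D → FreeAlgebra R (L ⊕ L)
  | 0, _, _ => fun p => FreeAlgebra.ι R (Sum.inl (w p))
  | k + 1, v, τ =>
    let g := factor w k (Fin.tail v) (Fin.tail τ)
    Function.update g (τ 0) (derW (v 0) (g (τ 0)))

theorem Bplus_mono {D k : ℕ} (w : Fin D → L) (v : Fin k → L → FreeAlgebra R L) :
    Bplus (List.ofFn v) (mono w) =
      ∑ τ : Fin k → Fin D, diag (List.ofFn (factor w k v τ)).prod := by
  have key : (List.ofFn v).foldr derW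
      (FreeAlgebra.lift R (fun j => FreeAlgebra.ι R (Sum.inl j : L ⊕ L)) (mono w)) =
      ∑ τ : Fin k → Fin D, (List.ofFn (factor w k v τ)).prod := by
    induction k with
    | zero => simp [mono, factor, map_list_prod, List.map_ofFn, Function.comp_def]
    | succ k ih =>
      rw [List.ofFn_succ, List.foldr_cons]
      have ih' := ih (Fin.tail v)
      simp only [Fin.tail_def] at ih'
      rw [ih', derW, der_sum, ← (Fin.consEquiv fun _ => Fin D).sum_comp,
        Fintype.sum_prod_type_right]
      refine Finset.sum_congr rfl fun τ _ => ?_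
      rw [leibniz_prod_ofFn _ (der_mul _)]
      refine Finset.sum_congr rfl fun p _ => ?_
      simp [factor, Fin.consEquiv, derW, Fin.tail_def]
  rw [← map_sum, ← key]
  rfl

theorem factor_of_injective {D k : ℕ} (w : Fin D → L) (v : Fin k → L → FreeAlgebra R L)
    (τ : Fin k → Fin D) (hτ : Function.Injective τ) :
    (∀ j, factor w k v τ (τ j) = inW (v j (w (τ j)))) ∧
      ∀ p, (∀ j, τ j ≠ p) → factor w k v τ p = FreeAlgebra.ι R (Sum.inl (w p)) := by
  induction k with
  | zero => exact ⟨fun j => j.elim0, fun _ _ => rfl⟩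
  | succ k ih =>
    have htail : Function.Injective (Fin.tail τ) := hτ.comp (Fin.succ_injective k)
    obtain ⟨h1, h2⟩ := ih (Fin.tail v) (Fin.tail τ) htail
    have h0 : ∀ j, Fin.tail τ j ≠ τ 0 := fun j h => Fin.succ_ne_zero j (hτ h)
    refine ⟨fun j => ?_, fun p hp => ?_⟩
    · cases j using Fin.cases with
      | zero => simp [factor, h2 _ h0, derW_ι_inl]
      | succ j =>
        have := h1 j
        exact (Function.update_of_ne (h0 j) _ _).trans this
    · simp only [factor]
      rw [Function.update_of_ne (hp 0).symm]
      exact h2 p fun j => hp j.succ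

theorem exists_factor_eq_zero {D k : ℕ} (w : Fin D → L) (v : Fin k → L → FreeAlgebra R L)
    (τ : Fin k → Fin D) (hτ : ¬ Function.Injective τ) : ∃ p, factor w k v τ p = 0 := by
  induction k with
  | zero => exact absurd (fun j => j.elim0) hτ
  | succ k ih =>
    by_cases htail : Function.Injective (Fin.tail τ)
    · have : ∃ j, Fin.tail τ j = τ 0 := by
        by_contra! h0
        apply hτ
        rw [← Fin.cons_self_tail τ, Fin.cons_injective_iff]
        exact ⟨by simpa using h0, htail⟩
      obtain ⟨j, hj⟩ := this
      refine ⟨τ 0, ?_⟩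
      have := (factor_of_injective w (Fin.tail v) (Fin.tail τ) htail).1 j
      rw [hj] at this
      simp [factor, this, derW_inW]
    · obtain ⟨p, hp⟩ := ih (Fin.tail v) (Fin.tail τ) htail
      refine ⟨p, ?_⟩
      by_cases h : p = τ 0
      · subst h
        simp [factor, hp, derW_zero]
      · simp [factor, Function.update_of_ne h, hp]

theorem exists_injective_of_Bplus_mono_ne_zero {D k : ℕ} (w : Fin D → L)
    (v : Fin k → L → FreeAlgebra R L) (h : Bplus (List.ofFn v) (mono w) ≠ 0) :
    ∃ τ : Fin k → Fin D, Function.Injective τ ∧ ∀ j, v j (w (τ j)) ≠ 0 := by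
  rw [Bplus_mono] at h
  obtain ⟨τ, -, hτ⟩ := Finset.exists_ne_zero_of_sum_ne_zero h
  have hne : ∀ p, factor w k v τ p ≠ 0 := fun p hp => hτ <| by
    rw [List.prod_eq_zero (List.mem_ofFn.2 ⟨p, hp⟩), map_zero]
  have hinj : Function.Injective τ := by
    by_contra hinj
    obtain ⟨p, hp⟩ := exists_factor_eq_zero w v τ hinj
    exact hne p hp
  refine ⟨τ, hinj, fun j hj => hne (τ j) ?_⟩
  rw [(factor_of_injective w v τ hinj).1 j, hj, map_zero]

/-- The evaluation with all variables equal to `1`. -/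
def evalOne : FreeAlgebra R L →ₐ[R] R := FreeAlgebra.lift R fun _ => 1

theorem evalOne_Bplus_mono {D k : ℕ} (w : Fin D → L) (v : Fin k → L → FreeAlgebra R L)
    (N : Fin k → L → ℕ) (hN : ∀ j i, evalOne (v j i) = N j i) :
    ∃ M : ℕ, evalOne (Bplus (List.ofFn v) (mono w)) = M ∧
      ∀ τ : Fin k → Fin D, Function.Injective τ → (∀ j, 0 < N j (w (τ j))) → 0 < M := by
  classical
  refine ⟨∑ τ : Fin k → Fin D, if Function.Injective τ then ∏ j, N j (w (τ j)) else 0, ?_, ?_⟩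
  · rw [Bplus_mono, map_sum, Nat.cast_sum]
    refine Finset.sum_congr rfl fun τ _ => ?_
    split_ifs with hτ
    · obtain ⟨h1, h2⟩ := factor_of_injective w v τ hτ
      rw [map_list_prod, map_list_prod, List.map_ofFn, List.map_ofFn, List.prod_ofFn,
        Nat.cast_prod]
      symm
      refine Fintype.prod_of_injective τ hτ _ _ (fun p hp => ?_) fun j => ?_
      · have := h2 p fun j hj => hp ⟨j, hj⟩
        simp [this, diag, evalOne]
      · simp [h1, diag_inW, hN]
    · obtain ⟨p, hp⟩ := exists_factor_eq_zero w v τ hτ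
      rw [List.prod_eq_zero (List.mem_ofFn.2 ⟨p, hp⟩)]
      simp
  · intro τ hτ hpos
    refine Finset.sum_pos' (fun _ _ => Nat.zero_le _) ⟨τ, Finset.mem_univ _, ?_⟩
    rw [if_pos hτ]
    exact Finset.prod_pos fun j _ => hpos j

theorem Bplus_zero (v : List (L → FreeAlgebra R L)) : Bplus v 0 = 0 := by
  have : v.foldr derW (0 : FreeAlgebra R (L ⊕ L)) = 0 := by
    induction v with
    | nil => rfl
    | cons u v ih => rw [List.foldr_cons, ih, derW_zero]
  have h : Bplus v 0 = diag (v.foldr derW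
    (FreeAlgebra.lift R (fun j => FreeAlgebra.ι R (Sum.inl j : L ⊕ L)) 0)) := rfl
  rw [h, map_zero, this, map_zero]

end Words

/-! ### The system attached to a tree -/

section System

open LTree

variable {K : Type*} [CommRing K] {W : Set ℕ+} {T : LTree W} {n D : ℕ} (E : Enum T n D)

open Classical in
/-- The family `H_{[m]}` of the tree `T`: one monomial for every subtree with root label `m`. -/
def treeFamily : W →₀ (Fin n → FreeAlgebra K (Fin n)) :=
  Finsupp.onFinset (Finset.univ.biUnion fun i => (optLabel (E.tree i)).toFinset)
    (fun m i => if optLabel (E.tree i) = some m then mono (E.word i) else 0) (by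
      intro m h
      obtain ⟨i, hi⟩ := Function.ne_iff.1 h
      have : optLabel (E.tree i) = some m := by
        by_contra hne
        simp [hne] at hi
      simp only [Finset.mem_biUnion, Finset.mem_univ, true_and, Option.mem_toFinset]
      exact ⟨i, this⟩)

open Classical in
theorem treeFamily_apply (m : W) (i : Fin n) : treeFamily (K := K) E m i =
    if optLabel (E.tree i) = some m then mono (E.word i) else 0 := rfl

theorem P_treeFamily_ne_zero (T' : LTree W) (i : Fin n)
    (h : P (treeFamily (K := K) E) T' i ≠ 0) : ∃ S, E.tree i = some S ∧
      T'.weight ≤ S.weight ∧ (T'.weight = S.weight → T'.Iso S) := by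
  classical
  induction T' generalizing i with
  | node m k c ih =>
    simp only [P, treeFamily_apply] at h
    split_ifs at h with hl
    · obtain ⟨d, c', hi⟩ := exists_of_optLabel_eq hl
      obtain ⟨τ, hτ, hne⟩ := exists_injective_of_Bplus_mono_ne_zero _ _ h
      have hj : ∀ j, ∃ q : Fin d, (q : ℕ) = τ j ∧ (c j).weight ≤ (c' q).weight ∧
          ((c j).weight = (c' q).weight → (c j).Iso (c' q)) := by
        intro j
        obtain ⟨S, hS, hS'⟩ := ih j _ (hne j)
        rw [E.tree_word i m d c' hi] at hS
        split_ifs at hS with hlt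
        cases hS
        exact ⟨_, rfl, hS'⟩
      choose σ hσ hσ' using hj
      refine ⟨_, hi, weight_le_and_iso_of_injective m c c' σ (fun a b hab => hτ ?_) hσ'⟩
      exact Fin.ext (by rw [← hσ, ← hσ, hab])
    · exact absurd (Bplus_zero _) h

theorem evalOne_P_treeFamily (T' : LTree W) (i : Fin n) :
    ∃ N : ℕ, evalOne (P (treeFamily (K := K) E) T' i) = N ∧ (E.tree i = some T' → 0 < N) := by
  classical
  induction T' generalizing i with
  | node m k c ih =>
    choose N hN hpos using ih
    simp only [P, treeFamily_apply]
    split_ifs with hl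
    · obtain ⟨M, hM, hM'⟩ := evalOne_Bplus_mono (E.word i)
        (fun j => P (treeFamily (K := K) E) (c j)) N hN
      refine ⟨M, hM, fun hi => ?_⟩
      have hk := E.arity_le i m k c hi
      refine hM' (Fin.castLE hk) (Fin.castLE_injective hk) fun j => hpos j _ ?_
      rw [E.tree_word i m k c hi]
      simp
    · refine ⟨0, by rw [Bplus_zero]; simp, fun hi => absurd ?_ hl⟩
      rw [hi]
      rfl

theorem evalOne_P_root_ne_zero [Algebra ℚ K] [Nontrivial K] :
    evalOne (P (treeFamily (K := K) E) T E.root) ≠ 0 := by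
  obtain ⟨N, hN, hpos⟩ := evalOne_P_treeFamily (K := K) E T E.root
  have := algebraRat.charZero K
  rw [hN, Nat.cast_ne_zero]
  exact (hpos E.tree_root).ne'

theorem P_treeFamily_eq_zero (T' : LTree W) (hw : T.weight ≤ T'.weight) (hT' : ¬ T'.Iso T) :
    P (treeFamily (K := K) E) T' = 0 := by
  funext i
  by_contra h
  obtain ⟨S, hS, hle, hiso⟩ := P_treeFamily_ne_zero E T' i h
  rcases E.lt_or_eq i S hS with hlt | rfl
  · omega
  · exact hT' (hiso (by omega))

/-- The coefficient of the monomial at the index `i` in `H_t`. -/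
def coeffAt (K : Type*) [CommRing K] (E : Enum T n D) (i : Fin n) : K[X] :=
  (optLabel (E.tree i)).elim 0 fun m => X ^ ((m : ℕ+) : ℕ)

theorem coeffAt_eval_zero (i : Fin n) : (coeffAt K E i).eval 0 = 0 := by
  rw [coeffAt]
  rcases optLabel (E.tree i) with _ | m
  · simp
  · simp [(m : ℕ+).ne_zero]

theorem optWeight_word_lt_of_coeffAt_ne_zero (i : Fin n) (h : coeffAt K E i ≠ 0)
    (p : Fin D) : optWeight (E.tree (E.word i p)) < optWeight (E.tree i) := by
  rcases hl : optLabel (E.tree i) with _ | m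
  · simp [coeffAt, hl] at h
  · exact E.optWeight_word_lt i m hl p

theorem mapCoeff_mono {R S L : Type*} [CommRing R] [CommRing S] (f : R →+* S) (w : Fin D → L) :
    mapCoeff f (mono w) = mono w := by
  simp [mono, map_list_prod, List.map_ofFn, Function.comp_def, mapCoeff_ι]

theorem treeFamily_sum (i : Fin n) : (treeFamily (K := K) E).sum (fun m h =>
      (X ^ ((m : ℕ+) : ℕ) : K[X]) • mapCoeff (C : K →+* K[X]) (h i)) =
    coeffAt K E i • mono (E.word i) := by
  classical
  rw [treeFamily, Finsupp.onFinset_sum _ (by simp)]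
  simp only [coeffAt]
  rcases hl : optLabel (E.tree i) with _ | m
  · simp
  · rw [Finset.sum_eq_single m]
    · simp [mapCoeff_mono]
    · intro b _ hb
      simp [hb.symm]
    · intro hm
      refine absurd ?_ hm
      simp only [Finset.mem_biUnion, Finset.mem_univ, true_and, Option.mem_toFinset]
      exact ⟨i, hl⟩

theorem exists_aut : ∃ F : FreeAlgebra K[X] (Fin n) ≃ₐ[K[X]] FreeAlgebra K[X] (Fin n),
    ∀ i, Hpart F i = coeffAt K E i • mono (E.word i) := by
  obtain ⟨F, hF⟩ := exists_algEquiv_of_triangular (R := K[X]) (FreeAlgebra.ι K[X] : Fin n → _)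
    (fun f => ⟨FreeAlgebra.lift K[X] f, fun i => by simp⟩)
    (fun φ ψ h => FreeAlgebra.hom_ext (funext h)) (coeffAt K E) E.word
    (fun i => optWeight (E.tree i)) (optWeight_word_lt_of_coeffAt_ne_zero E)
  exact ⟨F, fun i => by simp [Hpart, hF, mono]⟩

/-- The monomials of the system of a tree are triangular with respect to the weight. -/
theorem der_single_eq_zero (i j : Fin n)
    (hij : optWeight (E.tree i) ≤ optWeight (E.tree j)) (u : FreeAlgebra K[X] (Fin n)) :
    der (Pi.single j u) (coeffAt K E i • mono (E.word i)) = 0 := by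
  by_cases h : coeffAt K E i = 0
  · rw [h, zero_smul, der_zero]
  · rw [der_smul, der_mono_eq_zero, smul_zero]
    intro p
    have := optWeight_word_lt_of_coeffAt_ne_zero E i h p
    exact Pi.single_eq_of_ne (by rintro rfl; omega) _

theorem isHomogeneous_smul_mono {R L : Type*} [CommRing R] (a : R) (w : Fin D → L) :
    IsHomogeneous (a • mono (R := R) w) D :=
  Submodule.smul_mem _ _ (Submodule.subset_span ⟨w, rfl⟩)

theorem mem_triangularAut {α : ℕ} (hα : α ≤ D)
    (F : FreeAlgebra K[X] (Fin n) ≃ₐ[K[X]] FreeAlgebra K[X] (Fin n))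
    (hF : ∀ i, Hpart F i = coeffAt K E i • mono (E.word i)) : F ∈ triangularAut K α n := by
  refine ⟨fun i => ?_, ⟨D, hα, fun i => ?_⟩, ?_⟩
  · rw [hF, Algebra.smul_def, map_mul, mapCoeff_algebraMap, coe_evalRingHom, coeffAt_eval_zero]
    simp
  · rw [hF]
    exact isHomogeneous_smul_mono _ _
  · refine isPermStrictLower_of_rank _ (fun i => optWeight (E.tree i)) fun i j hij => ?_
    funext u
    simp only [jacobian, Matrix.of_apply, hF]
    exact der_single_eq_zero E i j hij u

end System

end NonComm

/-! ### Passage to commutative variables -/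

namespace Commut

open NonComm (mono)

section Abelianize

variable {R L : Type*} [CommRing R]

/-- The canonical map from noncommutative to commutative polynomials. -/
def ab : FreeAlgebra R L →ₐ[R] MvPolynomial L R := FreeAlgebra.lift R MvPolynomial.X

theorem ab_der (u : L → FreeAlgebra R L) (q : FreeAlgebra R L) :
    ab (NonComm.der u q) = MvPolynomial.mkDerivation R (fun i => ab (u i)) (ab q) := by
  induction q using FreeAlgebra.induction with
  | grade0 r => simp [NonComm.der_algebraMap]
  | grade1 i => simp [NonComm.der_ι, ab, MvPolynomial.mkDerivation_X]
  | mul a b ha hb =>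
    rw [NonComm.der_mul, map_add, map_mul, map_mul, map_mul, ha, hb, Derivation.leibniz,
      smul_eq_mul, smul_eq_mul, mul_comm (ab b)]
  | add a b ha hb => rw [NonComm.der_add, map_add, map_add, map_add, ha, hb]

theorem ab_Bplus (v : List (L → FreeAlgebra R L)) (q : FreeAlgebra R L) :
    ab (NonComm.Bplus v q) = Bplus (v.map fun u i => ab (u i)) (ab q) := by
  have hdiag : ∀ q : FreeAlgebra R (L ⊕ L), ab (NonComm.diag q) =
      MvPolynomial.aeval (Sum.elim MvPolynomial.X MvPolynomial.X) (ab q) := by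
    intro q
    have : (ab (R := R) (L := L)).comp NonComm.diag =
        (MvPolynomial.aeval (Sum.elim MvPolynomial.X MvPolynomial.X)).comp ab := by
      ext i
      rcases i with i | i <;> simp [ab, NonComm.diag]
    exact DFunLike.congr_fun this q
  have hin : ∀ (f : L → L ⊕ L) (q : FreeAlgebra R L),
      ab (FreeAlgebra.lift R (fun j => FreeAlgebra.ι R (f j)) q) =
        MvPolynomial.rename f (ab q) := by
    intro f q
    have : (ab (R := R) (L := L ⊕ L)).comp
        (FreeAlgebra.lift R (fun j => FreeAlgebra.ι R (f j))) =
        (MvPolynomial.rename f).comp ab := by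
      ext i
      simp [ab]
    exact DFunLike.congr_fun this q
  rw [Bplus, NonComm.Bplus]
  refine (hdiag _).trans (congrArg _ ?_)
  induction v with
  | nil => exact hin _ q
  | cons u v ih =>
    rw [List.foldr_cons, List.map_cons, List.foldr_cons, ← ih, ab_der]
    congr 2
    funext i
    rcases i with i | i
    · exact hin _ _
    · simp

theorem ab_P {W : Type} (H : W → L → FreeAlgebra R L) (T : LTree W) (i : L) :
    P (fun m i => ab (H m i)) T i = ab (NonComm.P H T i) := by
  induction T generalizing i with
  | node m d c ih =>
    simp only [P, NonComm.P, ab_Bplus, List.map_ofFn]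
    congr 2
    funext j i
    exact ih j i

theorem ab_mapCoeff {S : Type*} [CommRing S] (f : R →+* S) (q : FreeAlgebra R L) :
    ab (NonComm.mapCoeff f q) = MvPolynomial.map f (ab q) := by
  induction q using FreeAlgebra.induction with
  | grade0 r => simp [NonComm.mapCoeff_algebraMap, MvPolynomial.algebraMap_eq]
  | grade1 i => simp [NonComm.mapCoeff_ι, ab]
  | mul a b ha hb => simp [ha, hb]
  | add a b ha hb => simp [ha, hb]

theorem ab_mono {D : ℕ} (w : Fin D → L) :
    ab (R := R) (mono w) = (List.ofFn fun p => MvPolynomial.X (w p)).prod := by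
  simp [mono, ab, map_list_prod, List.map_ofFn, Function.comp_def]

theorem isHomogeneous_ab_smul_mono {D : ℕ} (a : R) (w : Fin D → L) :
    (ab (a • mono (R := R) w)).IsHomogeneous D := by
  rw [map_smul, ab_mono, List.prod_ofFn, MvPolynomial.smul_eq_C_mul]
  have h := MvPolynomial.IsHomogeneous.prod (R := R) Finset.univ
    (fun p : Fin D => MvPolynomial.X (w p)) (fun _ => 1)
    fun p _ => MvPolynomial.isHomogeneous_X R (w p)
  simpa using (MvPolynomial.isHomogeneous_C L a).mul h

theorem eval_one_ab (q : FreeAlgebra R L) :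
    MvPolynomial.aeval (fun _ => (1 : R)) (ab q) = NonComm.evalOne q := by
  have : (MvPolynomial.aeval (fun _ => (1 : R))).comp ab = NonComm.evalOne (L := L) := by
    ext i
    simp [ab, NonComm.evalOne]
  exact DFunLike.congr_fun this q

end Abelianize

section System

open LTree NonComm

variable {K : Type*} [CommRing K] {W : Set ℕ+} {T : LTree W} {n D : ℕ} (E : Enum T n D)

/-- The commutative family `H_{[m]}` of the tree `T`. -/
def abFamily (H : W →₀ (Fin n → FreeAlgebra K (Fin n))) :
    W →₀ (Fin n → MvPolynomial (Fin n) K) :=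
  H.mapRange (fun h i => ab (h i)) (by funext i; simp)

theorem exists_aut : ∃ F : MvPolynomial (Fin n) K[X] ≃ₐ[K[X]] MvPolynomial (Fin n) K[X],
    ∀ i, Hpart F i = ab (coeffAt K E i • mono (E.word i)) := by
  obtain ⟨F, hF⟩ := exists_algEquiv_of_triangular (R := K[X]) (MvPolynomial.X : Fin n → _)
    (fun f => ⟨MvPolynomial.aeval f, fun i => by simp⟩)
    (fun φ ψ h => MvPolynomial.algHom_ext h) (coeffAt K E) E.word
    (fun i => optWeight (E.tree i)) (optWeight_word_lt_of_coeffAt_ne_zero E)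
  exact ⟨F, fun i => by simp [Hpart, hF, ab_mono]⟩

theorem mem_triangularAut {α : ℕ} (hα : α ≤ D)
    (F : MvPolynomial (Fin n) K[X] ≃ₐ[K[X]] MvPolynomial (Fin n) K[X])
    (hF : ∀ i, Hpart F i = ab (coeffAt K E i • mono (E.word i))) : F ∈ triangularAut K α n := by
  refine ⟨fun i => ?_, ⟨D, hα, fun i => ?_⟩, ?_⟩
  · rw [hF, ← ab_mapCoeff, Algebra.smul_def, map_mul, mapCoeff_algebraMap, coe_evalRingHom,
      coeffAt_eval_zero]
    simp
  · rw [hF]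
    exact isHomogeneous_ab_smul_mono _ _
  · refine isPermStrictLower_of_rank _ (fun i => optWeight (E.tree i)) fun i j hij => ?_
    simp only [jacobian, Matrix.of_apply, hF]
    have h := congrArg ab (der_single_eq_zero (K := K) E i j hij 1)
    rw [ab_der, map_zero] at h
    rw [← h, MvPolynomial.pderiv]
    congr 2
    funext k
    by_cases hk : k = j
    · subst hk; simp
    · simp [hk]

theorem isExpansion_abFamily
    (F : MvPolynomial (Fin n) K[X] ≃ₐ[K[X]] MvPolynomial (Fin n) K[X])
    (hF : ∀ i, Hpart F i = ab (coeffAt K E i • mono (E.word i))) :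
    IsExpansion F (abFamily (treeFamily E)) := by
  intro i
  rw [hF, ← treeFamily_sum, abFamily, Finsupp.sum_mapRange_index (by simp), Finsupp.sum,
    Finsupp.sum, map_sum]
  exact Finset.sum_congr rfl fun m _ => by rw [map_smul, ab_mapCoeff]

end System

end Commut

end

theorem lemma5p4 (K : Type*) [CommRing K] [Algebra ℚ K] [Nontrivial K]
    (α : ℕ) (hα : 1 ≤ α) (W : Set ℕ+) (T : LTree W) :
    (∃ n : ℕ, 1 ≤ n ∧ ∃ F ∈ NonComm.triangularAut K α n,
      ∃ H : W →₀ (Fin n → FreeAlgebra K (Fin n)), NonComm.IsExpansion F H ∧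
        NonComm.P H T ≠ 0 ∧
        ∀ T' : LTree W, T.weight ≤ T'.weight → ¬ T'.Iso T → NonComm.P H T' = 0) ∧
    (∃ n : ℕ, 1 ≤ n ∧ ∃ F ∈ Commut.triangularAut K α n,
      ∃ H : W →₀ (Fin n → MvPolynomial (Fin n) K), Commut.IsExpansion F H ∧
        Commut.P H T ≠ 0 ∧
        ∀ T' : LTree W, T.weight ≤ T'.weight → ¬ T'.Iso T → Commut.P H T' = 0) := by
  obtain ⟨n, D, hn, hD, ⟨E⟩⟩ := T.exists_enum α
  constructor
  · obtain ⟨F, hF⟩ := NonComm.exists_aut (K := K) E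
    refine ⟨n, hn, F, NonComm.mem_triangularAut E hD F hF, NonComm.treeFamily E,
      fun i => by rw [hF, NonComm.treeFamily_sum], fun h => ?_,
      fun T' => NonComm.P_treeFamily_eq_zero E T'⟩
    apply NonComm.evalOne_P_root_ne_zero (K := K) E
    rw [h, Pi.zero_apply, map_zero]
  · obtain ⟨F, hF⟩ := Commut.exists_aut (K := K) E
    have hP : ∀ T' i, Commut.P (Commut.abFamily (NonComm.treeFamily (K := K) E)) T' i =
        Commut.ab (NonComm.P (NonComm.treeFamily E) T' i) :=
      fun T' i => Commut.ab_P (NonComm.treeFamily E) T' i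
    refine ⟨n, hn, F, Commut.mem_triangularAut E hD F hF,
      Commut.abFamily (NonComm.treeFamily E), Commut.isExpansion_abFamily E F hF, fun h => ?_,
      fun T' hw hT' => funext fun i => ?_⟩
    · apply NonComm.evalOne_P_root_ne_zero (K := K) E
      rw [← Commut.eval_one_ab, ← hP, h, Pi.zero_apply, map_zero]
    · rw [hP, NonComm.P_treeFamily_eq_zero E T' hw hT', Pi.zero_apply, map_zero]
      rfl
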